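/- Conventions. A labelled open graph $\Gamma=(G,I,O,\lambda)$ is a finite simple graph $G=(V,E)$ with sets $I,O\subseteq V$ and a labelling $\lambda:\overline{O}\to\{X,Y,Z,XY,XZ,YZ\}$, where $\overline{S}=V\setminus S$. For $A\subseteq V$, $\mathrm{Odd}(A)$ is the set of vertices with an odd number of neighbours in $A$, and $\mathrm{Odd}[A]=\mathrm{Odd}(A)\,\Delta\,A$. A Pauli flow on $\Gamma$ is a pair $(c,\prec)$ of a function $c:\overline{O}\to\mathcal{P}(\overline{I})$ and a strict partial order $\prec$ on $\overline{O}$ such that for all $u\in\overline{O}$: - for all $v\in\overline{O}\setminus\{u\}$: if $v\in c(u)$ and $\lambda(v)\notin\{X,Y\}$ then $u\prec v$; if $v\in\mathrm{Odd}(c(u))$ and $\lambda(v)\notin\{Y,Z\}$ then $u\prec v$; if $v\in\mathrm{Odd}[c(u)]$ and $\lambda(v)=Y$ then $u\prec v$; - if $\lambda(u)=XY$ then $u\notin c(u)$ and $u\in\mathrm{Odd}(c(u))$; if $\lambda(u)=XZ$ then $u\in c(u)$ and $u\in\mathrm{Odd}(c(u))$; if $\lambda(u)=YZ$ then $u\in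 c(u)$ and $u\notin\mathrm{Odd}(c(u))$; if $\lambda(u)=X$ then $u\in\mathrm{Odd}(c(u))$; if $\lambda(u)=Z$ then $u\in c(u)$; if $\lambda(u)=Y$ then $u\in\mathrm{Odd}[c(u)]$. It is focused if for all $v\in\overline{O}$ and all $w\in\overline{O}\setminus\{v\}$: $w\in c(v)$ implies $\lambda(w)\in\{XY,X,Y\}$; $w\in\mathrm{Odd}(c(v))$ implies $\lambda(w)\in\{XZ,YZ,Y,Z\}$; and $\lambda(w)=Y$ implies $w\notin\mathrm{Odd}[c(v)]$. A gflow is a Pauli flow on a labelled open graph all of whose labels are planar, i.e. in $\{XY,XZ,YZ\}$. Statement. Let $\Gamma=(G,I,O,\lambda)$ be a labelled open graph with $|I|=|O|$, let $a\in\overline{O}\cap\overline{I}$ with $\lambda(a)=XY$, and let $b\in\overline{O}$ be a neighbour of $a$ with $\lambda(b)=XY$. Let $\Gamma'$ be the result of splitting $a$ over $W=\{b\}$: add two new vertices $x',x''$, both labelled $XY$, delete the edge $\{a,b\}$, and add the edges $\{a,x'\}$, $\{x',x''\}$, $\{x'',b\}$; the inputs, the outputs and all other labels are unchanged. Then $\Gamma'$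 has a Pauli flow if and only if there is a focused Pauli flow $(c,\prec)$ on $\Gamma$ such that 1. $a\in c(b)$ or $b\in c(a)$, and 2. no vertex lies strictly between $a$ and $b$: for all $u\in\overline{O}$, $a\prec u$ implies $\neg(u\prec b)$, and $u\prec a$ implies $\neg(b\prec u)$. Moreover, if all labels of $\Gamma$ are planar, then so are all labels of $\Gamma'$, and $\Gamma'$ has a gflow if and only if there is a focused gflow $(c,\prec)$ on $\Gamma$ satisfying 1 and 2. -/

import Mathlib

open scoped symmDiff

/-- The six measurement labels: three Pauli measurements and three planar measurements. -/
inductive MeasurementLabel where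
  | X | Y | Z | XY | XZ | YZ
  deriving DecidableEq

/-- The labels of planar measurements. -/
def MeasurementLabel.IsPlanar (l : MeasurementLabel) : Prop :=
  l = .XY ∨ l = .XZ ∨ l = .YZ

/-- The odd neighbourhood of `A`: the symmetric difference of the neighbourhoods of the elements
of `A`, that is, the set of vertices with an odd number of neighbours in `A`. -/
def oddNbhd {V : Type*} (G : SimpleGraph V) (A : Set V) : Set V :=
  {v | Odd (A ∩ G.neighborSet v).ncard}

/-- The closed odd neighbourhood of `A`. -/
def closedOddNbhd {V : Type*} (G : SimpleGraph V) (A : Set V) : Set V :=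
  oddNbhd G A ∆ A

/-- A labelled open graph on the vertex set `V`: a simple graph, sets `I` of inputs and `O` of
outputs, and a measurement label for each non-output vertex. -/
structure LabelledOpenGraph (V : Type*) where
  graph : SimpleGraph V
  I : Set V
  O : Set V
  label : {v : V // v ∉ O} → MeasurementLabel

namespace LabelledOpenGraph

/-- The type of non-output vertices. -/
abbrev NonOutput {V : Type*} (Γ : LabelledOpenGraph V) : Type _ := {v : V // v ∉ Γ.O}

/-- `(c, r)` is a Pauli flow: `c` assigns to each non-output vertex a set of non-input vertices,
`r` is a strict partial order on the non-output vertices, and conditions (P1) to (P9) hold. -/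
structure IsPauliFlow {V : Type*} (Γ : LabelledOpenGraph V) (c : Γ.NonOutput → Set V)
    (r : Γ.NonOutput → Γ.NonOutput → Prop) : Prop where
  strictOrder : IsStrictOrder Γ.NonOutput r
  subset : ∀ u, c u ⊆ Γ.Iᶜ
  p1 : ∀ u v : Γ.NonOutput, (v : V) ∈ c u → u ≠ v →
    Γ.label v ≠ .X → Γ.label v ≠ .Y → r u v
  p2 : ∀ u v : Γ.NonOutput, (v : V) ∈ oddNbhd Γ.graph (c u) → u ≠ v →
    Γ.label v ≠ .Y → Γ.label v ≠ .Z → r u v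
  p3 : ∀ u v : Γ.NonOutput, ¬ r u v → u ≠ v → Γ.label v = .Y →
    (v : V) ∉ closedOddNbhd Γ.graph (c u)
  p4 : ∀ u, Γ.label u = .XY → (u : V) ∉ c u ∧ (u : V) ∈ oddNbhd Γ.graph (c u)
  p5 : ∀ u, Γ.label u = .XZ → (u : V) ∈ c u ∧ (u : V) ∈ oddNbhd Γ.graph (c u)
  p6 : ∀ u, Γ.label u = .YZ → (u : V) ∈ c u ∧ (u : V) ∉ oddNbhd Γ.graph (c u)
  p7 : ∀ u, Γ.label u = .X → (u : V) ∈ oddNbhd Γ.graph (c u)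
  p8 : ∀ u, Γ.label u = .Z → (u : V) ∈ c u
  p9 : ∀ u, Γ.label u = .Y → (u : V) ∈ closedOddNbhd Γ.graph (c u)

/-- The set `A` (of non-input vertices) is focused over the set `S` of non-output vertices. -/
structure IsFocusedOver {V : Type*} (Γ : LabelledOpenGraph V) (A : Set V)
    (S : Set Γ.NonOutput) : Prop where
  f1 : ∀ w ∈ S, (w : V) ∈ A → Γ.label w = .XY ∨ Γ.label w = .X ∨ Γ.label w = .Y
  f2 : ∀ w ∈ S, (w : V) ∈ oddNbhd Γ.graph A →
    Γ.label w = .XZ ∨ Γ.label w = .YZ ∨ Γ.label w = .Y ∨ Γ.label w = .Z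
  f3 : ∀ w ∈ S, Γ.label w = .Y → (w : V) ∉ closedOddNbhd Γ.graph A

/-- The function `c` is focused: each `c v` is focused over all non-output vertices other
than `v`. -/
def IsFocused {V : Type*} (Γ : LabelledOpenGraph V) (c : Γ.NonOutput → Set V) : Prop :=
  ∀ v, Γ.IsFocusedOver (c v) {v}ᶜ

/-- There is a Pauli flow on `Γ`. -/
def HasPauliFlow {V : Type*} (Γ : LabelledOpenGraph V) : Prop :=
  ∃ (c : Γ.NonOutput → Set V) (r : Γ.NonOutput → Γ.NonOutput → Prop), Γ.IsPauliFlow c r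

/-- All measurements are planar. -/
def AllPlanar {V : Type*} (Γ : LabelledOpenGraph V) : Prop :=
  ∀ v, (Γ.label v).IsPlanar

/-- A gflow is a Pauli flow on a labelled open graph in which all measurements are planar. -/
structure IsGFlow {V : Type*} (Γ : LabelledOpenGraph V) (c : Γ.NonOutput → Set V)
    (r : Γ.NonOutput → Γ.NonOutput → Prop) : Prop where
  allPlanar : Γ.AllPlanar
  isPauliFlow : Γ.IsPauliFlow c r

/-- There is a gflow on `Γ`. -/
def HasGFlow {V : Type*} (Γ : LabelledOpenGraph V) : Prop :=
  ∃ (c : Γ.NonOutput → Set V) (r : Γ.NonOutput → Γ.NonOutput → Prop), Γ.IsGFlow c r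

/-- Splitting the vertex `x` over the set `W`. The new vertices are `x' = Sum.inr 0` and
`x'' = Sum.inr 1`; the edges `{x, x'}`, `{x', x''}` and `{x'', w}` for `w ∈ W` are added, and the
pairs `{x, w}` for `w ∈ W` are toggled. Both new vertices are labelled `XY`. Meant for a
non-input, non-output vertex `x` with label `XY` and `x ∉ W`. -/
def split {V : Type*} (Γ : LabelledOpenGraph V) (x : V) (W : Set V) :
    LabelledOpenGraph (V ⊕ Fin 2) where
  graph := SimpleGraph.fromEdgeSet
    ((Sym2.map Sum.inl '' Γ.graph.edgeSet) ∆
      {s(Sum.inl x, Sum.inr 0), s(Sum.inr 0, Sum.inr 1)} ∆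
      {e | ∃ w ∈ W, e = s(Sum.inl x, Sum.inl w) ∨ e = s(Sum.inr 1, Sum.inl w)})
  I := Sum.inl '' Γ.I
  O := Sum.inl '' Γ.O
  label
    | ⟨Sum.inl v, h⟩ => Γ.label ⟨v, fun hv => h ⟨v, hv, rfl⟩⟩
    | ⟨Sum.inr _, _⟩ => .XY

end LabelledOpenGraph

/-!
Identify sets of vertices with vectors over `ZMod 2`. Each non-output vertex `v` then carries two
linear functionals, `demand v` and `orderDemand v`. For a Pauli flow with correction vectors `x u`,
the matrix `demand v (x u)` is unitriangular and the matrix `orderDemand v (x u)` is strictly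
triangular for the order; the flow is focused exactly when the first matrix is the identity
(`isFocusedVecFlow_iff`). Dividing by the unitriangular matrix focuses any Pauli flow
(`IsVecFlow.exists_isFocusedVecFlow`). If there are as many inputs as outputs, the functionals
`demand v` form a square matrix, so the focused correction vectors are its inverse and are unique
(`IsFocusedVecFlow.ext_demand`). A focused Pauli flow is thus an inverse matrix for which the
relation `D u v`, meaning `orderDemand v (x u) = 1`, is acyclic.

Splitting `a` over `{b}` adds rows and columns for `x'` (`splitNew` at `0`) and `x''` (`splitNew` at
`1`). The demands of `x'` and `x''` are `[a] + [x'']` and `[b] + [x']`, where `[w]` is the coordinate at `w`, and the demands of `a` and `b`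
change by the demands of `x''` and `x'`. Hence the new matrix is invertible exactly when the old one
is, the correction vectors of `x''` and `x'` restrict to those of `a` and `b`, and in `D` the
vertices `x''` and `x'` behave as copies of `a` and `b`, except that `D x'' x'` and `D x' x''` are
the *negations* of `D a b` and `D b a`. The new relation is acyclic if and only if the old one is,
exactly one of `D a b` and `D b a` holds (otherwise the new vertices form a 2-cycle), and the
reversed arc between the new vertices closes no cycle, which says that no chain of `D` of length at
least two joins `a` and `b`. The two directions are `IsFocusedVecFlow.exists_of_split` and
`IsFocusedVecFlow.exists_split`.
-/

namespace LabelledOpenGraph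

variable {V : Type*}

/-! ### Sets of vertices as vectors over `ZMod 2` -/

open Classical in
/-- The characteristic vector of a set of vertices. -/
noncomputable def charVec (A : Set V) : V → ZMod 2 := fun v => if v ∈ A then 1 else 0

/-- The set of vertices on which a vector over `ZMod 2` equals `1`. -/
def oneSet (x : V → ZMod 2) : Set V := {v | x v = 1}

theorem zmod_two_cases (z : ZMod 2) : z = 0 ∨ z = 1 := by
  revert z; decide

@[simp] theorem charVec_oneSet (x : V → ZMod 2) : charVec (oneSet x) = x := by
  funext v
  rcases zmod_two_cases (x v) with h | h <;> simp [charVec, oneSet, h]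

theorem mem_iff_charVec {A : Set V} {v : V} : v ∈ A ↔ charVec A v = 1 := by
  by_cases h : v ∈ A <;> simp [charVec, h]

open Classical in
/-- The adjacency operator over `ZMod 2`: it sends the characteristic vector of `A` to that of the
odd neighbourhood of `A`. -/
noncomputable def oddMap [Fintype V] (G : SimpleGraph V) :
    (V → ZMod 2) →ₗ[ZMod 2] (V → ZMod 2) where
  toFun x v := ∑ w, if G.Adj v w then x w else 0
  map_add' x y := by
    funext v
    simp only [Pi.add_apply, ← Finset.sum_add_distrib]
    exact Finset.sum_congr rfl fun w _ => by split_ifs <;> simp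
  map_smul' t x := by
    funext v
    simp [Finset.mul_sum]

open Classical in
theorem oddMap_apply [Fintype V] (G : SimpleGraph V) (x : V → ZMod 2) (v : V) :
    oddMap G x v = ∑ w, if G.Adj v w then x w else 0 := rfl

theorem mem_oddNbhd_iff [Fintype V] {G : SimpleGraph V} {A : Set V} {v : V} :
    v ∈ oddNbhd G A ↔ oddMap G (charVec A) v = 1 := by
  classical
  have h : oddMap G (charVec A) v = ((A ∩ G.neighborSet v).ncard : ZMod 2) := by
    rw [Set.ncard_eq_toFinset_card', oddMap_apply]
    simp only [charVec, ← ite_and]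
    rw [Finset.sum_boole]
    congr 2
    ext w
    simp [and_comm]
  rw [h, ZMod.natCast_eq_one_iff_odd]
  rfl

theorem mem_closedOddNbhd_iff [Fintype V] {G : SimpleGraph V} {A : Set V} {v : V} :
    v ∈ closedOddNbhd G A ↔ oddMap G (charVec A) v + charVec A v = 1 := by
  rw [closedOddNbhd, Set.mem_symmDiff, mem_oddNbhd_iff, mem_iff_charVec]
  generalize oddMap G (charVec A) v = o
  generalize charVec A v = i
  revert o i; decide

/-! ### Demand functionals -/

/-- The functional at `v` that takes the value `1` on sets correcting `v` and has to vanish on every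
other set of a focused flow: the odd
neighbourhood for `X` and `XY`, membership for `Z`, `XZ` and `YZ`, and the closed odd
neighbourhood for `Y`. -/
noncomputable def demand [Fintype V] (Γ : LabelledOpenGraph V) (v : Γ.NonOutput) :
    (V → ZMod 2) →ₗ[ZMod 2] ZMod 2 :=
  match Γ.label v with
  | .X | .XY => LinearMap.proj (v : V) ∘ₗ oddMap Γ.graph
  | .Z | .XZ | .YZ => LinearMap.proj (v : V)
  | .Y => LinearMap.proj (v : V) ∘ₗ oddMap Γ.graph + LinearMap.proj (v : V)

/-- The functional at `v` whose value `1` on the correction set of `u` forces `u` to precede `v` in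
a focused flow: membership for
`XY`, the closed odd neighbourhood for `XZ`, the odd neighbourhood for `YZ`, and nothing for the
Pauli labels. -/
noncomputable def orderDemand [Fintype V] (Γ : LabelledOpenGraph V) (v : Γ.NonOutput) :
    (V → ZMod 2) →ₗ[ZMod 2] ZMod 2 :=
  match Γ.label v with
  | .XY => LinearMap.proj (v : V)
  | .XZ => LinearMap.proj (v : V) ∘ₗ oddMap Γ.graph + LinearMap.proj (v : V)
  | .YZ => LinearMap.proj (v : V) ∘ₗ oddMap Γ.graph
  | .X | .Y | .Z => 0

/-- The form of a Pauli flow in terms of characteristic vectors: the matrix of demands is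
unitriangular and the matrix of order demands is strictly triangular with respect to `r`. -/
structure IsVecFlow [Fintype V] (Γ : LabelledOpenGraph V) (x : Γ.NonOutput → V → ZMod 2)
    (r : Γ.NonOutput → Γ.NonOutput → Prop) : Prop where
  strictOrder : IsStrictOrder Γ.NonOutput r
  vanish : ∀ u, ∀ i ∈ Γ.I, x u i = 0
  demand_self : ∀ u, Γ.demand u (x u) = 1
  demand_ne : ∀ u v, u ≠ v → Γ.demand v (x u) = 1 → r u v
  orderDemand : ∀ u v, Γ.orderDemand v (x u) = 1 → r u v

/-- The form of a focused Pauli flow in terms of characteristic vectors: the matrix of demands is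
the identity and the matrix of order demands is strictly triangular with respect to `r`. -/
structure IsFocusedVecFlow [Fintype V] (Γ : LabelledOpenGraph V) (x : Γ.NonOutput → V → ZMod 2)
    (r : Γ.NonOutput → Γ.NonOutput → Prop) : Prop where
  strictOrder : IsStrictOrder Γ.NonOutput r
  vanish : ∀ u, ∀ i ∈ Γ.I, x u i = 0
  demand_self : ∀ u, Γ.demand u (x u) = 1
  demand_ne : ∀ u v, u ≠ v → Γ.demand v (x u) = 0
  orderDemand : ∀ u v, Γ.orderDemand v (x u) = 1 → r u v

theorem vanish_iff {A I : Set V} : (∀ i ∈ I, charVec A i = 0) ↔ A ⊆ Iᶜ := by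
  refine ⟨fun h v hv hi => ?_, fun h i hi => ?_⟩
  · rw [mem_iff_charVec, h v hi] at hv
    exact zero_ne_one hv
  · exact (zmod_two_cases _).resolve_right fun h1 => h (mem_iff_charVec.2 h1) hi

theorem IsPauliFlow.isVecFlow [Fintype V] {Γ : LabelledOpenGraph V} {c : Γ.NonOutput → Set V}
    {r : Γ.NonOutput → Γ.NonOutput → Prop} (h : Γ.IsPauliFlow c r) :
    Γ.IsVecFlow (fun u => charVec (c u)) r := by
  refine ⟨h.strictOrder, fun u => vanish_iff.2 (h.subset u), fun u => ?_, fun u v huv => ?_,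
    fun u v => ?_⟩
  · have h4 := h.p4 u; have h5 := h.p5 u; have h6 := h.p6 u
    have h7 := h.p7 u; have h8 := h.p8 u; have h9 := h.p9 u
    clear h
    simp only [mem_oddNbhd_iff, mem_closedOddNbhd_iff] at *
    simp only [mem_iff_charVec] at *
    unfold demand
    cases hl : Γ.label u <;> simp_all
  · have h1 := h.p1 u v; have h2 := h.p2 u v; have h3 := h.p3 u v
    clear h
    simp only [mem_oddNbhd_iff, mem_closedOddNbhd_iff] at *
    simp only [mem_iff_charVec] at *
    unfold demand
    cases hl : Γ.label v <;> simp_all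
    tauto
  · have h1 := h.p1 u v; have h2 := h.p2 u v
    have h4 := h.p4 u; have h5 := h.p5 u; have h6 := h.p6 u
    clear h
    have hi := zmod_two_cases (charVec (c u) v)
    simp only [mem_oddNbhd_iff] at *
    simp only [mem_iff_charVec] at *
    unfold LabelledOpenGraph.orderDemand
    by_cases huv : u = v
    · subst huv
      cases hl : Γ.label u <;> simp_all
    · cases hl : Γ.label v <;> simp_all
      rcases hi with hi | hi <;> simp_all

theorem isFocusedVecFlow_iff [Fintype V] {Γ : LabelledOpenGraph V} {c : Γ.NonOutput → Set V}
    {r : Γ.NonOutput → Γ.NonOutput → Prop} :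
    Γ.IsFocusedVecFlow (fun u => charVec (c u)) r ↔ Γ.IsPauliFlow c r ∧ Γ.IsFocused c := by
  constructor
  · rintro ⟨hs, hI, hd, hn, ho⟩
    have key : ∀ u v, u ≠ v → (charVec (c u) v = 1 → Γ.label v = .XY ∧ r u v ∨ Γ.label v = .X ∨
          Γ.label v = .Y) ∧
        (oddMap Γ.graph (charVec (c u)) v = 1 → (Γ.label v = .XZ ∨ Γ.label v = .YZ) ∧ r u v ∨
          Γ.label v = .Y ∨ Γ.label v = .Z) ∧
        (Γ.label v = .Y → ¬ oddMap Γ.graph (charVec (c u)) v + charVec (c u) v = 1) := by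
      intro u v huv
      have h1 := hn u v huv
      have h2 := ho u v
      unfold demand at h1
      unfold LabelledOpenGraph.orderDemand at h2
      cases hl : Γ.label v <;> simp_all
    have self : ∀ u, ¬ Γ.orderDemand u (charVec (c u)) = 1 := fun u h => hs.irrefl u (ho u u h)
    refine ⟨⟨hs, fun u => vanish_iff.1 (hI u), ?_, ?_, ?_, ?_, ?_, ?_, ?_, ?_, ?_⟩,
      fun u => ⟨?_, ?_, ?_⟩⟩ <;>
      (try simp only [mem_oddNbhd_iff, mem_closedOddNbhd_iff]) <;>
      (try simp only [mem_iff_charVec])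
    · intro u v h huv hX hY
      have := (key u v huv).1 h
      tauto
    · intro u v h huv hX hY
      have := (key u v huv).2.1 h
      tauto
    · intro u v _ huv hl
      exact (key u v huv).2.2 hl
    iterate 3
      intro u hl
      have h1 := hd u
      have h2 := self u
      unfold demand at h1
      unfold LabelledOpenGraph.orderDemand at h2
      simp only [hl, LinearMap.coe_comp, LinearMap.add_apply, Function.comp_apply,
        LinearMap.coe_proj, Function.eval] at h1 h2
      revert h1 h2
      generalize oddMap Γ.graph (charVec (c u)) u = o
      generalize charVec (c u) u = i
      revert o i
      decide
    iterate 3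
      intro u hl
      have h1 := hd u
      unfold demand at h1
      simpa [hl] using h1
    · intro w hw h
      have := (key u w fun e => mem_iff_charVec.2 hw e.symm).1 h
      tauto
    · intro w hw h
      have := (key u w fun e => mem_iff_charVec.2 hw e.symm).2.1 h
      tauto
    · intro w hw
      exact (key u w fun e => mem_iff_charVec.2 hw e.symm).2.2
  · rintro ⟨h, hf⟩
    refine ⟨h.strictOrder, h.isVecFlow.vanish, h.isVecFlow.demand_self, fun u v huv => ?_,
      h.isVecFlow.orderDemand⟩
    have h1 := (hf u).f1 v (Ne.symm huv)
    have h2 := (hf u).f2 v (Ne.symm huv)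
    have h3 := (hf u).f3 v (Ne.symm huv)
    simp only [mem_oddNbhd_iff, mem_closedOddNbhd_iff] at h1 h2 h3
    simp only [mem_iff_charVec] at h1 h2 h3
    refine (zmod_two_cases _).resolve_right fun hd => ?_
    unfold demand at hd
    cases hl : Γ.label v <;> simp_all

/-! ### Focusing and uniqueness -/

/-- Multiplying the matrix of a Pauli flow by the inverse of its unitriangular matrix of demands
gives a focused Pauli flow for the same order. The columns of the product are found by recursion
along the order. -/
theorem IsVecFlow.exists_isFocusedVecFlow [Fintype V] {Γ : LabelledOpenGraph V}
    {x : Γ.NonOutput → V → ZMod 2} {r : Γ.NonOutput → Γ.NonOutput → Prop}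
    (h : Γ.IsVecFlow x r) : ∃ y, Γ.IsFocusedVecFlow y r := by
  classical
  have := h.strictOrder
  suffices H : ∀ u, ∃ y : V → ZMod 2, (∀ i ∈ Γ.I, y i = 0) ∧
      (∀ v, Γ.demand v y = if u = v then 1 else 0) ∧ ∀ v, Γ.orderDemand v y = 1 → r u v by
    choose y hI hd ho using H
    exact ⟨y, h.strictOrder, hI, fun u => by simp [hd], fun u v huv => by simp [hd, huv], ho⟩
  have wf : WellFounded (flip r) := by
    have : IsStrictOrder Γ.NonOutput (flip r) :=
      { irrefl := fun u => h.strictOrder.irrefl u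
        trans := fun a b c h1 h2 => h.strictOrder.trans _ _ _ h2 h1 }
    exact Finite.wellFounded_of_trans_of_irrefl _
  intro u
  induction u using wf.induction with
  | _ u ih =>
    have ih' : ∀ w, ∃ y : V → ZMod 2, r u w → (∀ i ∈ Γ.I, y i = 0) ∧
        (∀ v, Γ.demand v y = if w = v then 1 else 0) ∧ ∀ v, Γ.orderDemand v y = 1 → r w v := by
      intro w
      by_cases hw : r u w
      · obtain ⟨y, hy⟩ := ih w hw
        exact ⟨y, fun _ => hy⟩
      · exact ⟨0, fun h => absurd h hw⟩
    choose y hy using ih'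
    refine ⟨x u + ∑ w with r u w, Γ.demand w (x u) • y w, fun i hi => ?_, fun v => ?_,
      fun v hv => ?_⟩
    · rw [Pi.add_apply, h.vanish u i hi, Finset.sum_apply, zero_add]
      refine Finset.sum_eq_zero fun w hw => ?_
      simp [(hy w (Finset.mem_filter.1 hw).2).1 i hi]
    · have : ∑ w with r u w, Γ.demand w (x u) • Γ.demand v (y w) =
          if r u v then Γ.demand v (x u) else 0 := by
        rw [Finset.sum_filter]
        rw [Finset.sum_eq_single v]
        · split_ifs with hv
          · simp [(hy v hv).2.1]
          · rfl
        · intro w _ hwv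
          split_ifs with hw
          · simp [(hy w hw).2.1, hwv]
          · rfl
        · simp
      rw [map_add, map_sum]
      simp only [map_smul]
      rw [this]
      by_cases huv : u = v
      · subst huv
        simp [h.demand_self, h.strictOrder.irrefl u]
      · rcases zmod_two_cases (Γ.demand v (x u)) with h0 | h1
        · simp [h0, huv]
        · simp [h1, huv, h.demand_ne u v huv h1, CharTwo.add_self_eq_zero]
    · by_contra hr
      have h0 : Γ.orderDemand v (x u) = 0 :=
        (zmod_two_cases _).resolve_right fun h1 => hr (h.orderDemand u v h1)
      rw [map_add, map_sum, h0, Finset.sum_eq_zero] at hv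
      · simp at hv
      · intro w hw
        have hw := (Finset.mem_filter.1 hw).2
        rw [map_smul, (zmod_two_cases _).resolve_right fun h1 =>
          hr (h.strictOrder.trans _ _ _ hw ((hy w hw).2.2 v h1)), smul_zero]

/-- With as many inputs as outputs the matrix of demands is square, hence a focused Pauli flow is
an inverse of it, and vectors vanishing on the inputs are determined by their demands. -/
theorem IsFocusedVecFlow.ext_demand [Fintype V] {Γ : LabelledOpenGraph V}
    (hcard : Γ.I.ncard = Γ.O.ncard) {x : Γ.NonOutput → V → ZMod 2}
    {r : Γ.NonOutput → Γ.NonOutput → Prop} (h : Γ.IsFocusedVecFlow x r) {y z : V → ZMod 2}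
    (hy : ∀ i ∈ Γ.I, y i = 0) (hz : ∀ i ∈ Γ.I, z i = 0)
    (hyz : ∀ v, Γ.demand v y = Γ.demand v z) : y = z := by
  classical
  let S : Submodule (ZMod 2) (V → ZMod 2) :=
    { carrier := {x | ∀ i ∈ Γ.I, x i = 0}
      add_mem' := fun {p q} hp hq i hi => by simp [hp i hi, hq i hi]
      zero_mem' := fun _ _ => rfl
      smul_mem' := fun t p hp i hi => by simp [hp i hi] }
  let e : S ≃ₗ[ZMod 2] ({v // v ∉ Γ.I} → ZMod 2) :=
    { toFun := fun p v => p.1 v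
      map_add' := fun _ _ => rfl
      map_smul' := fun _ _ => rfl
      invFun := fun f => ⟨fun v => if hv : v ∈ Γ.I then 0 else f ⟨v, hv⟩,
        fun i hi => by simp [hi]⟩
      left_inv := fun p => by
        ext v
        by_cases hv : v ∈ Γ.I
        · simp [hv, p.2 v hv]
        · simp [hv]
      right_inv := fun f => by
        funext v
        simp [v.2] }
  let Φ : S →ₗ[ZMod 2] (Γ.NonOutput → ZMod 2) := LinearMap.pi fun v => Γ.demand v ∘ₗ S.subtype
  have hsurj : Function.Surjective Φ := by
    intro f
    refine ⟨∑ u, f u • ⟨x u, h.vanish u⟩, ?_⟩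
    funext v
    rw [map_sum, Finset.sum_apply, Finset.sum_eq_single v]
    · simp [Φ, h.demand_self]
    · intro u _ huv
      simp [Φ, h.demand_ne u v huv]
    · simp
  have hdim : Module.finrank (ZMod 2) S = Module.finrank (ZMod 2) (Γ.NonOutput → ZMod 2) := by
    rw [e.finrank_eq, Module.finrank_fintype_fun_eq_card, Module.finrank_fintype_fun_eq_card,
      ← Nat.card_eq_fintype_card, ← Nat.card_eq_fintype_card]
    have h1 := Set.ncard_add_ncard_compl Γ.I
    have h2 := Set.ncard_add_ncard_compl Γ.O
    have h3 : Γ.Iᶜ.ncard = Γ.Oᶜ.ncard := by omega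
    exact h3
  have hinj := (LinearMap.injective_iff_surjective_of_finrank_eq_finrank hdim).2 hsurj
  have := @hinj ⟨y, hy⟩ ⟨z, hz⟩ (funext hyz)
  exact congrArg Subtype.val this

/-! ### The split graph -/

/-- A non-output vertex as a vertex of the split graph. -/
def splitOld (Γ : LabelledOpenGraph V) (a : V) (W : Set V) (u : Γ.NonOutput) :
    (Γ.split a W).NonOutput :=
  ⟨Sum.inl u, by rintro ⟨v, hv, h⟩; exact u.2 (Sum.inl.inj h ▸ hv)⟩

/-- A new vertex as a non-output vertex of the split graph. -/
def splitNew (Γ : LabelledOpenGraph V) (a : V) (W : Set V) (i : Fin 2) :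
    (Γ.split a W).NonOutput :=
  ⟨Sum.inr i, by rintro ⟨v, hv, h⟩; cases h⟩

theorem split_nonOutput_cases {Γ : LabelledOpenGraph V} {a : V} {W : Set V}
    {p : (Γ.split a W).NonOutput → Prop} (old : ∀ u, p (Γ.splitOld a W u))
    (zero : p (Γ.splitNew a W 0)) (one : p (Γ.splitNew a W 1)) (s) : p s := by
  obtain ⟨v | i, hv⟩ := s
  · exact old ⟨v, fun h => hv ⟨v, h, rfl⟩⟩
  · match i with
    | 0 => exact zero
    | 1 => exact one

section

variable {Γ : LabelledOpenGraph V} {a b : V}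

theorem split_adj_old_old (hab : Γ.graph.Adj a b) (u v : V) :
    (Γ.split a {b}).graph.Adj (Sum.inl u) (Sum.inl v) ↔
      Γ.graph.Adj u v ∧ ¬ (u = a ∧ v = b) ∧ ¬ (u = b ∧ v = a) := by
  have h1 : s(Sum.inl u, Sum.inl v) ∈ (Sym2.map (Sum.inl : V → V ⊕ Fin 2) '' Γ.graph.edgeSet) ↔
      Γ.graph.Adj u v := by
    rw [← Sym2.map_mk, (Sym2.map.injective Sum.inl_injective).mem_set_image,
      SimpleGraph.mem_edgeSet]
  simp only [split, SimpleGraph.fromEdgeSet_adj, Set.mem_symmDiff, h1]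
  have := hab.symm
  by_cases hua : u = a <;> by_cases hvb : v = b <;> by_cases hub : u = b <;>
    by_cases hva : v = a <;> simp_all
  all_goals exact SimpleGraph.Adj.ne

theorem split_adj_old_new (u : V) (i : Fin 2) :
    (Γ.split a {b}).graph.Adj (Sum.inl u) (Sum.inr i) ↔
      (i = 0 ∧ u = a) ∨ (i = 1 ∧ u = b) := by
  have h1 : s(Sum.inl u, Sum.inr i) ∉ (Sym2.map (Sum.inl : V → V ⊕ Fin 2) '' Γ.graph.edgeSet) := by
    rintro ⟨e, -, he⟩
    induction e with | _ p q => simp at he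
  simp only [split, SimpleGraph.fromEdgeSet_adj, Set.mem_symmDiff, h1]
  fin_cases i <;> simp

theorem split_adj_new_new (i j : Fin 2) :
    (Γ.split a {b}).graph.Adj (Sum.inr i) (Sum.inr j) ↔ i ≠ j := by
  have h1 : s(Sum.inr i, Sum.inr j) ∉ (Sym2.map (Sum.inl : V → V ⊕ Fin 2) '' Γ.graph.edgeSet) := by
    rintro ⟨e, -, he⟩
    induction e with | _ p q => simp at he
  simp only [split, SimpleGraph.fromEdgeSet_adj, Set.mem_symmDiff, h1]
  fin_cases i <;> fin_cases j <;> simp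

open Classical in
theorem oddMap_split_old [Fintype V] (hab : Γ.graph.Adj a b) (x : V ⊕ Fin 2 → ZMod 2) (v : V) :
    oddMap (Γ.split a {b}).graph x (Sum.inl v) = oddMap Γ.graph (x ∘ Sum.inl) v +
      (if v = a then x (Sum.inl b) + x (Sum.inr 0) else 0) +
      (if v = b then x (Sum.inl a) + x (Sum.inr 1) else 0) := by
  have hne := hab.ne
  have h1 : ∀ w, (if (Γ.split a {b}).graph.Adj (Sum.inl v) (Sum.inl w) then x (Sum.inl w) else 0) =
      (if Γ.graph.Adj v w then x (Sum.inl w) else 0) +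
        (if w = b then if v = a then x (Sum.inl b) else 0 else 0) +
        (if w = a then if v = b then x (Sum.inl a) else 0 else 0) := by
    intro w
    have := hab.symm
    by_cases hva : v = a <;> by_cases hvb : v = b <;> by_cases hwa : w = a <;>
      by_cases hwb : w = b <;> simp_all [split_adj_old_old, CharTwo.add_self_eq_zero]
  rw [oddMap_apply, Fintype.sum_sum_type, Fin.sum_univ_two, oddMap_apply]
  simp only [h1, Finset.sum_add_distrib, split_adj_old_new, Finset.sum_ite_eq',
    Finset.mem_univ, Function.comp_apply]
  by_cases hva : v = a <;> by_cases hvb : v = b <;> simp_all [add_assoc]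

theorem oddMap_split_zero [Fintype V] (x : V ⊕ Fin 2 → ZMod 2) :
    oddMap (Γ.split a {b}).graph x (Sum.inr 0) = x (Sum.inl a) + x (Sum.inr 1) := by
  classical
  rw [oddMap_apply, Fintype.sum_sum_type, Fin.sum_univ_two]
  simp [SimpleGraph.adj_comm _ (Sum.inr _) (Sum.inl _), split_adj_old_new, split_adj_new_new]

theorem oddMap_split_one [Fintype V] (x : V ⊕ Fin 2 → ZMod 2) :
    oddMap (Γ.split a {b}).graph x (Sum.inr 1) = x (Sum.inl b) + x (Sum.inr 0) := by
  classical
  rw [oddMap_apply, Fintype.sum_sum_type, Fin.sum_univ_two]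
  simp [SimpleGraph.adj_comm _ (Sum.inr _) (Sum.inl _), split_adj_old_new, split_adj_new_new]

end

section

variable {Γ : LabelledOpenGraph V} {a b : Γ.NonOutput}

open Classical in
/-- The rows of the matrix of demands for `a` and `b` after splitting differ from those before
splitting by the rows for `x''` and `x'`. -/
theorem demand_split_old [Fintype V] (ha : Γ.label a = .XY) (hb : Γ.label b = .XY)
    (hab : Γ.graph.Adj a b) (y : V ⊕ Fin 2 → ZMod 2) (u : Γ.NonOutput) :
    (Γ.split a {(b : V)}).demand (Γ.splitOld a {(b : V)} u) y = Γ.demand u (y ∘ Sum.inl) +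
      (if u = a then y (Sum.inl b) + y (Sum.inr 0) else 0) +
      (if u = b then y (Sum.inl a) + y (Sum.inr 1) else 0) := by
  have hl : (Γ.split a {(b : V)}).label (Γ.splitOld a {(b : V)} u) = Γ.label u := rfl
  have hv : ((Γ.splitOld a {(b : V)} u : _) : V ⊕ Fin 2) = Sum.inl (u : V) := rfl
  have hua : (u : V) = a ↔ u = a := Subtype.ext_iff.symm
  have hub : (u : V) = b ↔ u = b := Subtype.ext_iff.symm
  have hna : Γ.label u ≠ .XY → u ≠ a := by rintro h rfl; exact h ha
  have hnb : Γ.label u ≠ .XY → u ≠ b := by rintro h rfl; exact h hb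
  unfold demand
  rw [hl, hv]
  cases h : Γ.label u <;> simp_all [oddMap_split_old]

theorem demand_split_zero [Fintype V] (y : V ⊕ Fin 2 → ZMod 2) :
    (Γ.split a {(b : V)}).demand (Γ.splitNew a {(b : V)} 0) y =
      y (Sum.inl a) + y (Sum.inr 1) :=
  oddMap_split_zero y

theorem demand_split_one [Fintype V] (y : V ⊕ Fin 2 → ZMod 2) :
    (Γ.split a {(b : V)}).demand (Γ.splitNew a {(b : V)} 1) y =
      y (Sum.inl b) + y (Sum.inr 0) :=
  oddMap_split_one y

/-- No correction term appears: the neighbourhood changes only at `a` and `b`, and these are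
labelled `XY`, where the order demand is membership. -/
theorem orderDemand_split_old [Fintype V] (ha : Γ.label a = .XY) (hb : Γ.label b = .XY)
    (hab : Γ.graph.Adj a b) (y : V ⊕ Fin 2 → ZMod 2) (u : Γ.NonOutput) :
    (Γ.split a {(b : V)}).orderDemand (Γ.splitOld a {(b : V)} u) y =
      Γ.orderDemand u (y ∘ Sum.inl) := by
  have hl : (Γ.split a {(b : V)}).label (Γ.splitOld a {(b : V)} u) = Γ.label u := rfl
  have hv : ((Γ.splitOld a {(b : V)} u : _) : V ⊕ Fin 2) = Sum.inl (u : V) := rfl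
  have hua : (u : V) = a ↔ u = a := Subtype.ext_iff.symm
  have hub : (u : V) = b ↔ u = b := Subtype.ext_iff.symm
  have hna : Γ.label u ≠ .XY → u ≠ a := by rintro h rfl; exact h ha
  have hnb : Γ.label u ≠ .XY → u ≠ b := by rintro h rfl; exact h hb
  unfold orderDemand
  rw [hl, hv]
  cases h : Γ.label u <;> simp_all [oddMap_split_old]

theorem orderDemand_of_label_eq_XY [Fintype V] {u : Γ.NonOutput} (hu : Γ.label u = .XY)
    (x : V → ZMod 2) : Γ.orderDemand u x = x u := by
  unfold orderDemand
  rw [hu]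
  rfl

theorem orderDemand_split_new [Fintype V] (y : V ⊕ Fin 2 → ZMod 2) (i : Fin 2) :
    (Γ.split a {(b : V)}).orderDemand (Γ.splitNew a {(b : V)} i) y = y (Sum.inr i) := rfl

open Classical in
/-- The vertex of the original graph whose correction set a non-output vertex of the split graph
inherits: itself for an old vertex, and crosswise `b` for `x'` and `a` for `x''`. -/
noncomputable def splitProj (Γ : LabelledOpenGraph V) (a b : Γ.NonOutput)
    (s : (Γ.split a {(b : V)}).NonOutput) : Γ.NonOutput :=
  if h : ∃ u, s = Γ.splitOld a {(b : V)} u then h.choose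
  else if s = Γ.splitNew a {(b : V)} 0 then b else a

theorem splitOld_injective : Function.Injective (Γ.splitOld a {(b : V)}) := fun _ _ h =>
  Subtype.ext (Sum.inl.inj (congrArg Subtype.val h))

theorem splitNew_ne_splitOld (i : Fin 2) (u : Γ.NonOutput) :
    Γ.splitNew a {(b : V)} i ≠ Γ.splitOld a {(b : V)} u := fun h => by
  have := congrArg Subtype.val h
  cases this

theorem splitNew_one_ne_zero : Γ.splitNew a {(b : V)} 1 ≠ Γ.splitNew a {(b : V)} 0 := fun h => by
  have := Sum.inr.inj (congrArg Subtype.val h)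
  exact absurd this (by decide)

@[simp] theorem splitProj_old (u : Γ.NonOutput) :
    Γ.splitProj a b (Γ.splitOld a {(b : V)} u) = u := by
  have h : ∃ w, Γ.splitOld a {(b : V)} u = Γ.splitOld a {(b : V)} w := ⟨u, rfl⟩
  rw [splitProj, dif_pos h]
  exact (splitOld_injective h.choose_spec).symm

@[simp] theorem splitProj_zero : Γ.splitProj a b (Γ.splitNew a {(b : V)} 0) = b := by
  rw [splitProj, dif_neg (fun ⟨u, h⟩ => splitNew_ne_splitOld 0 u h), if_pos rfl]

@[simp] theorem splitProj_one : Γ.splitProj a b (Γ.splitNew a {(b : V)} 1) = a := by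
  rw [splitProj, dif_neg (fun ⟨u, h⟩ => splitNew_ne_splitOld 1 u h), if_neg splitNew_one_ne_zero]

/-! ### From the split graph to the original graph -/

/-- The columns of a focused Pauli flow on the split graph restrict to columns of the inverse
matrix of demands of the original graph. -/
theorem demand_restrict [Fintype V] (ha : Γ.label a = .XY) (hb : Γ.label b = .XY)
    (hab : Γ.graph.Adj a b) {y : (Γ.split a {(b : V)}).NonOutput → V ⊕ Fin 2 → ZMod 2}
    {r : (Γ.split a {(b : V)}).NonOutput → (Γ.split a {(b : V)}).NonOutput → Prop}
    (h : (Γ.split a {(b : V)}).IsFocusedVecFlow y r) [DecidableEq Γ.NonOutput] (s)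
    (v : Γ.NonOutput) :
    Γ.demand v (y s ∘ Sum.inl) = if Γ.splitProj a b s = v then 1 else 0 := by
  classical
  have hne : a ≠ b := fun h => hab.ne (congrArg Subtype.val h)
  have hd : ∀ s t, (Γ.split a {(b : V)}).demand t (y s) = if s = t then 1 else 0 := by
    intro s t
    split_ifs with hst
    · exact hst ▸ h.demand_self s
    · exact h.demand_ne s t hst
  have h1 := hd s (Γ.splitOld a {(b : V)} v)
  rw [demand_split_old ha hb hab, ← demand_split_one, ← demand_split_zero, hd, hd] at h1
  induction s using split_nonOutput_cases with
  | old u =>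
    simpa [(splitNew_ne_splitOld _ _).symm, splitOld_injective.eq_iff] using h1
  | zero =>
    simp only [splitNew_ne_splitOld, splitNew_one_ne_zero.symm, if_true, if_false, ite_self,
      add_zero] at h1
    rw [splitProj_zero]
    rw [CharTwo.add_eq_zero] at h1
    simp [h1, eq_comm]
  | one =>
    simp only [splitNew_ne_splitOld, splitNew_one_ne_zero, if_true, if_false, ite_self,
      add_zero] at h1
    rw [splitProj_one]
    rw [CharTwo.add_eq_zero] at h1
    simp [h1, eq_comm]

/-- The witness order is the transitive closure of the relation `D` of order demands, the least
possible one: a vertex between `a` and `b` then comes with a chain of order demands, which lifts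
to a chain between `x''` and `x'` and contradicts the reversed arc between these two. -/
theorem IsFocusedVecFlow.exists_of_split [Fintype V] (hcard : Γ.I.ncard = Γ.O.ncard)
    (ha : Γ.label a = .XY) (hb : Γ.label b = .XY) (hab : Γ.graph.Adj a b)
    {y : (Γ.split a {(b : V)}).NonOutput → V ⊕ Fin 2 → ZMod 2}
    {r' : (Γ.split a {(b : V)}).NonOutput → (Γ.split a {(b : V)}).NonOutput → Prop}
    (h : (Γ.split a {(b : V)}).IsFocusedVecFlow y r') :
    ∃ x r, Γ.IsFocusedVecFlow x r ∧ (x b a = 1 ∨ x a b = 1) ∧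
      ∀ u, (r a u → ¬ r u b) ∧ (r u a → ¬ r b u) := by
  classical
  let x : Γ.NonOutput → V → ZMod 2 := fun u => y (Γ.splitOld a {(b : V)} u) ∘ Sum.inl
  let D : Γ.NonOutput → Γ.NonOutput → Prop := fun u v => Γ.orderDemand v (x u) = 1
  have trans : ∀ {s t w}, r' s t → r' t w → r' s w := fun h1 h2 =>
    h.strictOrder.trans _ _ _ h1 h2
  have irrefl : ∀ {s}, ¬ r' s s := fun h1 => h.strictOrder.irrefl _ h1
  have hI : ∀ s, ∀ i ∈ Γ.I, (y s ∘ Sum.inl) i = 0 := fun s i hi => h.vanish s _ ⟨i, hi, rfl⟩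
  have hd : ∀ u v, Γ.demand v (x u) = if u = v then 1 else 0 := fun u v => by
    rw [demand_restrict ha hb hab h, splitProj_old]
  have hold : ∀ s v, Γ.orderDemand v (y s ∘ Sum.inl) = 1 → r' s (Γ.splitOld a {(b : V)} v) := by
    intro s v hv
    exact h.orderDemand s _ (by rwa [orderDemand_split_old ha hb hab])
  have hpath : ∀ {u v}, Relation.TransGen D u v →
      r' (Γ.splitOld a {(b : V)} u) (Γ.splitOld a {(b : V)} v) := by
    intro u v huv
    induction huv with
    | single h1 => exact hold _ _ h1
    | tail _ h1 ih => exact trans ih (hold _ _ h1)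
  have hflow : Γ.IsFocusedVecFlow x (Relation.TransGen D) :=
    { strictOrder :=
        { irrefl := fun u hu => irrefl (hpath hu)
          trans := fun _ _ _ h1 h2 => h1.trans h2 }
      vanish := fun u => hI _
      demand_self := fun u => by rw [hd, if_pos rfl]
      demand_ne := fun u v huv => by rw [hd, if_neg huv]
      orderDemand := fun u v huv => .single huv }
  -- Uniqueness of focused correction sets: those of `x'` and `x''` restrict to those of `b`, `a`.
  have hres : ∀ s, y s ∘ Sum.inl = x (Γ.splitProj a b s) := fun s =>
    hflow.ext_demand hcard (hI s) (hI _) fun v => by rw [demand_restrict ha hb hab h, hd]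
  have hzero : ∀ s, s ≠ Γ.splitNew a {(b : V)} 1 → D (Γ.splitProj a b s) b →
      r' s (Γ.splitNew a {(b : V)} 0) := by
    intro s hs hD
    refine h.orderDemand s _ ?_
    have h0 := h.demand_ne s _ hs
    rw [demand_split_one, CharTwo.add_eq_zero] at h0
    have h1 := congrFun (hres s) b
    simp only [D, orderDemand_of_label_eq_XY hb] at hD
    rw [orderDemand_split_new, ← h0, ← hD, ← h1]
    rfl
  have hone : ∀ s, s ≠ Γ.splitNew a {(b : V)} 0 → D (Γ.splitProj a b s) a →
      r' s (Γ.splitNew a {(b : V)} 1) := by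
    intro s hs hD
    refine h.orderDemand s _ ?_
    have h0 := h.demand_ne s _ hs
    rw [demand_split_zero, CharTwo.add_eq_zero] at h0
    have h1 := congrFun (hres s) a
    simp only [D, orderDemand_of_label_eq_XY ha] at hD
    rw [orderDemand_split_new, ← h0, ← hD, ← h1]
    rfl
  -- The arcs between `x''` and `x'` are the negations of those between `a` and `b`.
  have h10 : ¬ D a b → r' (Γ.splitNew a {(b : V)} 1) (Γ.splitNew a {(b : V)} 0) := by
    intro hD
    refine h.orderDemand _ _ ?_
    have h0 := h.demand_self (Γ.splitNew a {(b : V)} 1)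
    have h1 := congrFun (hres (Γ.splitNew a {(b : V)} 1)) b
    simp only [D, orderDemand_of_label_eq_XY hb] at hD
    rw [splitProj_one, (zmod_two_cases _).resolve_right hD] at h1
    rw [demand_split_one] at h0
    rw [orderDemand_split_new, ← h0, show y _ (Sum.inl (b : V)) = 0 from h1, zero_add]
  have h01 : ¬ D b a → r' (Γ.splitNew a {(b : V)} 0) (Γ.splitNew a {(b : V)} 1) := by
    intro hD
    refine h.orderDemand _ _ ?_
    have h0 := h.demand_self (Γ.splitNew a {(b : V)} 0)
    have h1 := congrFun (hres (Γ.splitNew a {(b : V)} 0)) a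
    simp only [D, orderDemand_of_label_eq_XY ha] at hD
    rw [splitProj_zero, (zmod_two_cases _).resolve_right hD] at h1
    rw [demand_split_zero] at h0
    rw [orderDemand_split_new, ← h0, show y _ (Sum.inl (a : V)) = 0 from h1, zero_add]
  have hfrom : ∀ s {v}, Relation.TransGen D (Γ.splitProj a b s) v →
      r' s (Γ.splitOld a {(b : V)} v) := by
    intro s v hv
    induction hv with
    | single h1 => exact hold _ _ (by rwa [hres])
    | tail _ h1 ih => exact trans ih (hold _ _ h1)
  have hto0 : ∀ {u}, Relation.TransGen D u b →
      r' (Γ.splitOld a {(b : V)} u) (Γ.splitNew a {(b : V)} 0) := by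
    intro u hu
    cases hu with
    | single h1 => exact hzero _ (splitNew_ne_splitOld _ _).symm (by simpa using h1)
    | tail h1 h2 =>
      exact trans (hpath h1) (hzero _ (splitNew_ne_splitOld _ _).symm (by simpa using h2))
  have hto1 : ∀ {u}, Relation.TransGen D u a →
      r' (Γ.splitOld a {(b : V)} u) (Γ.splitNew a {(b : V)} 1) := by
    intro u hu
    cases hu with
    | single h1 => exact hone _ (splitNew_ne_splitOld _ _).symm (by simpa using h1)
    | tail h1 h2 =>
      exact trans (hpath h1) (hone _ (splitNew_ne_splitOld _ _).symm (by simpa using h2))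
  have hor : D a b ∨ D b a := by
    by_contra! hc
    exact irrefl (trans (h10 hc.1) (h01 hc.2))
  have hacyc : ∀ {u v}, D u v → ¬ Relation.TransGen D v u := fun h1 h2 =>
    irrefl (hpath ((Relation.TransGen.single h1).trans h2))
  refine ⟨x, Relation.TransGen D, hflow, ?_, fun u => ⟨fun h1 h2 => ?_, fun h1 h2 => ?_⟩⟩
  · simp only [D, orderDemand_of_label_eq_XY ha, orderDemand_of_label_eq_XY hb] at hor
    exact hor.symm
  · rcases hor with hD | hD
    · exact irrefl (trans (trans (hfrom (Γ.splitNew a {(b : V)} 1) (by rwa [splitProj_one]))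
        (hto0 h2)) (h01 fun h3 => hacyc hD (.single h3)))
    · exact hacyc hD (h1.trans h2)
  · rcases hor with hD | hD
    · exact hacyc hD (h2.trans h1)
    · exact irrefl (trans (trans (hfrom (Γ.splitNew a {(b : V)} 0) (by rwa [splitProj_zero]))
        (hto1 h1)) (h10 fun h3 => hacyc hD (.single h3)))

/-! ### From the original graph to the split graph -/

/-- If nothing lies strictly between the images of `p` and `q`, then the pullback of a strict
order stays one after the arc from `p` to `q` is removed, and the reversed arc can be added. -/
theorem exists_strictOrder_reversing {α β : Type*} {r : α → α → Prop} (hr : IsStrictOrder α r)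
    (f : β → α) {p q : β} (hpq : p ≠ q) (hbtw : ∀ u, r (f p) u → ¬ r u (f q)) :
    ∃ s : β → β → Prop, IsStrictOrder β s ∧
      (∀ u v, r (f u) (f v) → ¬ (u = p ∧ v = q) → s u v) ∧ s q p := by
  let T : β → β → Prop := fun u v => r (f u) (f v) ∧ ¬ (u = p ∧ v = q)
  have hT : ∀ {u v w}, T u v → T v w → T u w := by
    rintro u v w ⟨h1, -⟩ ⟨h2, -⟩
    exact ⟨hr.trans _ _ _ h1 h2, by rintro ⟨rfl, rfl⟩; exact hbtw _ h1 h2⟩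
  have hirr : ∀ {u}, ¬ T u u := fun h => hr.irrefl _ h.1
  have hnot : ¬ T p q := fun h => h.2 ⟨rfl, rfl⟩
  refine ⟨fun u v => T u v ∨ (u = q ∨ T u q) ∧ (v = p ∨ T p v),
    { irrefl := ?_, trans := ?_ }, fun u v h1 h2 => Or.inl ⟨h1, h2⟩,
    Or.inr ⟨Or.inl rfl, Or.inl rfl⟩⟩
  · rintro u (h | ⟨rfl | h1, h2 | h2⟩)
    · exact hirr h
    · exact hpq h2.symm
    · exact hnot h2
    · exact hnot (h2 ▸ h1)
    · exact hnot (hT h2 h1)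
  · rintro u v w (h | ⟨h1, h2⟩) (h' | ⟨h1', h2'⟩)
    · exact Or.inl (hT h h')
    · refine Or.inr ⟨Or.inr ?_, h2'⟩
      rcases h1' with rfl | h1'
      · exact h
      · exact hT h h1'
    · refine Or.inr ⟨h1, Or.inr ?_⟩
      rcases h2 with rfl | h2
      · exact h'
      · exact hT h2 h'
    · exact Or.inr ⟨h1, h2'⟩

/-- The correction sets of `x'` and `x''` extend those of `b` and `a`. The order is pulled back
along `splitProj`, with the arc between the two new vertices reversed. -/
theorem IsFocusedVecFlow.exists_split [Fintype V] (ha : Γ.label a = .XY) (hb : Γ.label b = .XY)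
    (hab : Γ.graph.Adj a b) {x : Γ.NonOutput → V → ZMod 2}
    {r : Γ.NonOutput → Γ.NonOutput → Prop} (h : Γ.IsFocusedVecFlow x r)
    (hx : x b a = 1 ∨ x a b = 1) (hbtw : ∀ u, (r a u → ¬ r u b) ∧ (r u a → ¬ r b u)) :
    ∃ y r', (Γ.split a {(b : V)}).IsFocusedVecFlow y r' := by
  classical
  -- The entries at the new vertices are forced by the demands of the new vertices.
  let y : (Γ.split a {(b : V)}).NonOutput → V ⊕ Fin 2 → ZMod 2 := fun s =>
    Sum.elim (x (Γ.splitProj a b s))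
      ![x (Γ.splitProj a b s) b + if s = Γ.splitNew a {(b : V)} 1 then 1 else 0,
        x (Γ.splitProj a b s) a + if s = Γ.splitNew a {(b : V)} 0 then 1 else 0]
  have hd : ∀ u v, Γ.demand v (x u) = if u = v then 1 else 0 := by
    intro u v
    split_ifs with huv
    · exact huv ▸ h.demand_self u
    · exact h.demand_ne u v huv
  have hd' : ∀ s t, (Γ.split a {(b : V)}).demand t (y s) = if s = t then 1 else 0 := by
    intro s t
    have hyl : y s ∘ Sum.inl = x (Γ.splitProj a b s) := rfl
    have cancel : ∀ p q : ZMod 2, p + (p + q) = q := by decide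
    induction t using split_nonOutput_cases with
    | old v =>
      rw [demand_split_old ha hb hab, hyl, hd]
      simp only [y, Sum.elim_inl, Sum.elim_inr, Matrix.cons_val_zero, Matrix.cons_val_one, cancel]
      induction s using split_nonOutput_cases with
      | old u => simp [(splitNew_ne_splitOld _ _).symm, splitOld_injective.eq_iff]
      | zero =>
        by_cases hv : v = b
        · simp [hv, splitNew_ne_splitOld, splitNew_one_ne_zero.symm, CharTwo.add_self_eq_zero]
        · simp [hv, Ne.symm hv, splitNew_ne_splitOld, splitNew_one_ne_zero.symm]
      | one =>
        by_cases hv : v = a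
        · simp [hv, splitNew_ne_splitOld, splitNew_one_ne_zero, CharTwo.add_self_eq_zero]
        · simp [hv, Ne.symm hv, splitNew_ne_splitOld, splitNew_one_ne_zero]
    | zero => rw [demand_split_zero]; exact cancel _ _
    | one => rw [demand_split_one]; exact cancel _ _
  suffices H : ∃ r', IsStrictOrder _ r' ∧
      ∀ s t, (Γ.split a {(b : V)}).orderDemand t (y s) = 1 → r' s t by
    obtain ⟨r', hr', ho⟩ := H
    refine ⟨y, r', hr', ?_, fun s => by rw [hd', if_pos rfl],
      fun s t hst => by rw [hd', if_neg hst], ho⟩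
    rintro s _ ⟨i, hi, rfl⟩
    exact h.vanish _ i hi
  have hza : ∀ u, x u a = 1 → r u a := fun u hu =>
    h.orderDemand u a (by rwa [orderDemand_of_label_eq_XY ha])
  have hzb : ∀ u, x u b = 1 → r u b := fun u hu =>
    h.orderDemand u b (by rwa [orderDemand_of_label_eq_XY hb])
  have hy0 : ∀ s, s ≠ Γ.splitNew a {(b : V)} 1 → y s (Sum.inr 0) = 1 →
      r (Γ.splitProj a b s) b := fun s hs hy => hzb _ (by simpa [y, hs] using hy)
  have hy1 : ∀ s, s ≠ Γ.splitNew a {(b : V)} 0 → y s (Sum.inr 1) = 1 →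
      r (Γ.splitProj a b s) a := fun s hs hy => hza _ (by simpa [y, hs] using hy)
  have hy10 : y (Γ.splitNew a {(b : V)} 1) (Sum.inr 0) = x a b + 1 := by simp [y]
  have hy01 : y (Γ.splitNew a {(b : V)} 0) (Sum.inr 1) = x b a + 1 := by simp [y]
  rcases hx with hx | hx
  · obtain ⟨r', hr', hext, hrev⟩ := exists_strictOrder_reversing h.strictOrder (Γ.splitProj a b)
      (p := Γ.splitNew a {(b : V)} 0) (q := Γ.splitNew a {(b : V)} 1) splitNew_one_ne_zero.symm
      (fun u h1 h2 => (hbtw u).2 (by simpa using h2) (by simpa using h1))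
    refine ⟨r', hr', fun s t ht => ?_⟩
    induction t using split_nonOutput_cases with
    | old v =>
      rw [orderDemand_split_old ha hb hab] at ht
      exact hext _ _ (by simpa using h.orderDemand _ _ ht)
        fun hc => (splitNew_ne_splitOld _ _).symm hc.2
    | zero =>
      by_cases hs : s = Γ.splitNew a {(b : V)} 1
      · exact hs ▸ hrev
      · exact hext _ _ (by simpa using hy0 s hs ht) fun hc => splitNew_one_ne_zero hc.2.symm
    | one =>
      by_cases hs : s = Γ.splitNew a {(b : V)} 0
      · rw [hs, orderDemand_split_new, hy01, hx] at ht
        exact absurd ht (by decide)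
      · exact hext _ _ (by simpa using hy1 s hs ht) fun hc => hs hc.1
  · obtain ⟨r', hr', hext, hrev⟩ := exists_strictOrder_reversing h.strictOrder (Γ.splitProj a b)
      (p := Γ.splitNew a {(b : V)} 1) (q := Γ.splitNew a {(b : V)} 0) splitNew_one_ne_zero
      (fun u h1 h2 => (hbtw u).1 (by simpa using h1) (by simpa using h2))
    refine ⟨r', hr', fun s t ht => ?_⟩
    induction t using split_nonOutput_cases with
    | old v =>
      rw [orderDemand_split_old ha hb hab] at ht
      exact hext _ _ (by simpa using h.orderDemand _ _ ht)
        fun hc => (splitNew_ne_splitOld _ _).symm hc.2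
    | zero =>
      by_cases hs : s = Γ.splitNew a {(b : V)} 1
      · rw [hs, orderDemand_split_new, hy10, hx] at ht
        exact absurd ht (by decide)
      · exact hext _ _ (by simpa using hy0 s hs ht) fun hc => hs hc.1
    | one =>
      by_cases hs : s = Γ.splitNew a {(b : V)} 0
      · exact hs ▸ hrev
      · exact hext _ _ (by simpa using hy1 s hs ht) fun hc => splitNew_one_ne_zero hc.2

theorem hasPauliFlow_split_iff [Finite V] (hcard : Γ.I.ncard = Γ.O.ncard)
    (ha : Γ.label a = .XY) (hb : Γ.label b = .XY) (hab : Γ.graph.Adj a b) :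
    (Γ.split a {(b : V)}).HasPauliFlow ↔
      ∃ (c : Γ.NonOutput → Set V) (r : Γ.NonOutput → Γ.NonOutput → Prop),
        Γ.IsPauliFlow c r ∧ Γ.IsFocused c ∧
        ((a : V) ∈ c b ∨ (b : V) ∈ c a) ∧
        ∀ u, (r a u → ¬ r u b) ∧ (r u a → ¬ r b u) := by
  cases nonempty_fintype V
  constructor
  · rintro ⟨c', r', h'⟩
    obtain ⟨y, hy⟩ := h'.isVecFlow.exists_isFocusedVecFlow
    obtain ⟨x, r, h, hx, hbtw⟩ := hy.exists_of_split hcard ha hb hab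
    have h1 := (isFocusedVecFlow_iff (c := fun u => oneSet (x u)) (r := r)).1
      (by simpa only [charVec_oneSet] using h)
    exact ⟨fun u => oneSet (x u), r, h1.1, h1.2, hx, hbtw⟩
  · rintro ⟨c, r, h, hf, hx, hbtw⟩
    rw [mem_iff_charVec, mem_iff_charVec] at hx
    obtain ⟨y, r', hy⟩ := (isFocusedVecFlow_iff.2 ⟨h, hf⟩).exists_split ha hb hab hx hbtw
    have h1 := (isFocusedVecFlow_iff (c := fun u => oneSet (y u)) (r := r')).1
      (by simpa only [charVec_oneSet] using hy)
    exact ⟨_, r', h1.1⟩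

theorem AllPlanar.split (h : Γ.AllPlanar) (a : V) (W : Set V) : (Γ.split a W).AllPlanar := by
  intro s
  induction s using split_nonOutput_cases with
  | old u => exact h u
  | zero => exact Or.inl rfl
  | one => exact Or.inl rfl

end

end LabelledOpenGraph

theorem mainTheorem5 {V : Type*} [Finite V] (Γ : LabelledOpenGraph V)
    (hcard : Γ.I.ncard = Γ.O.ncard) (a b : Γ.NonOutput) (haI : (a : V) ∉ Γ.I)
    (ha : Γ.label a = .XY) (hb : Γ.label b = .XY) (hab : Γ.graph.Adj a b) :
    ((Γ.split a {(b : V)}).HasPauliFlow ↔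
      ∃ (c : Γ.NonOutput → Set V) (r : Γ.NonOutput → Γ.NonOutput → Prop),
        Γ.IsPauliFlow c r ∧ Γ.IsFocused c ∧
        ((a : V) ∈ c b ∨ (b : V) ∈ c a) ∧
        ∀ u, (r a u → ¬ r u b) ∧ (r u a → ¬ r b u)) ∧
    (Γ.AllPlanar →
      (Γ.split a {(b : V)}).AllPlanar ∧
      ((Γ.split a {(b : V)}).HasGFlow ↔
        ∃ (c : Γ.NonOutput → Set V) (r : Γ.NonOutput → Γ.NonOutput → Prop),
          Γ.IsGFlow c r ∧ Γ.IsFocused c ∧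
          ((a : V) ∈ c b ∨ (b : V) ∈ c a) ∧
          ∀ u, (r a u → ¬ r u b) ∧ (r u a → ¬ r b u))) := by
  have key := LabelledOpenGraph.hasPauliFlow_split_iff hcard ha hb hab
  refine ⟨key, fun hp => ⟨hp.split _ _, ?_⟩⟩
  constructor
  · rintro ⟨c', r', h'⟩
    obtain ⟨c, r, h, hrest⟩ := key.1 ⟨c', r', h'.isPauliFlow⟩
    exact ⟨c, r, ⟨hp, h⟩, hrest⟩
  · rintro ⟨c, r, h, hrest⟩
    obtain ⟨c', r', h'⟩ := key.2 ⟨c, r, h.isPauliFlow, hrest⟩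
    exact ⟨c', r', hp.split _ _, h'⟩
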